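/- Let $\Bbbk$ be an algebraically closed field of characteristic $p$, and let $H$ be a finite-dimensional semisimple Hopf algebra over $\Bbbk$ with counit $\varepsilon$ and antipode $S$, such that $p>\dim_{\Bbbk}(H)^{1/2}$ or $p=0$. An integral of $H$ is an element $\Lambda\in H$ with $h\Lambda=\varepsilon(h)\Lambda$ for all $h\in H$; for an integral $\Lambda$ put $\mathbf u_\Lambda=S(\Lambda_{(2)})\Lambda_{(1)}$. Let $V$ be a finite-dimensional representation of $H$ with character $\chi_V$. (a) $H$ has exactly one nonzero idempotent integral $\Lambda_0$. The element $\mathbf u_0:=\mathbf u_{\Lambda_0}$ is a unit of $H$ and $S^2(h)=\mathbf u_0h\mathbf u_0^{-1}$ for all $h\in H$. Hence $j:V\to V^{**}$, $j(v)(f)=f(\mathbf u_0v)$, is an isomorphism of $H$-modules (not necessarily a pivotal structure), and for every $n\ge1$ there is a linear operator $E_V^n$ on $\mathrm{Hom}_H(\Bbbk,V^{\otimes n})$ sending $f$ to the composite $$\Bbbk\xrightarrow{\mathrm{coev}_{V^*}}V^*\otimes V^{**}=V^*\otimes\Bbbk\otimes V^{**}\xrightarrow{\mathrm{id}\otimes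 f\otimes\mathrm{id}}V^*\otimes V^{\otimes n}\otimes V^{**}\xrightarrow{\mathrm{ev}_V\otimes\mathrm{id}}V^{\otimes(n-1)}\otimes V^{**}\xrightarrow{\mathrm{id}\otimes j^{-1}}V^{\otimes n}.$$ The $n$-th Frobenius–Schur indicator of $V$ is $\nu_n(V):=\mathrm{tr}(E_V^n)$. (b) For every nonzero integral $\Lambda$ of $H$, the element $\mathbf u=\mathbf u_\Lambda=S(\Lambda_{(2)})\Lambda_{(1)}$ is a unit of $H$, and for all $n\ge1$ $$\nu_n(V)=\chi_V\bigl(\mathbf u^{-1}\Lambda_{(1)}\Lambda_{(2)}\cdots\Lambda_{(n)}\bigr).$$ -/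

import Mathlib

open scoped TensorProduct

open Coalgebra

namespace HopfFS

noncomputable section

universe u v w₁ w₂ w₃ w₄

variable {k : Type u} {H : Type v} [Field k] [Ring H] [HopfAlgebra k H]
variable {V : Type w₁} {W : Type w₂} {X : Type w₃} {Y : Type w₄}
variable [AddCommMonoid V] [Module k V] [AddCommMonoid W] [Module k W]
variable [AddCommMonoid X] [Module k X] [AddCommMonoid Y] [Module k Y]

/-! ### Integrals, the element `S(Λ₍₂₎) Λ₍₁₎`, Sweedler powers -/

/-- `Λ` is a left integral of `H`: `h Λ = ε(h) Λ` for all `h`. -/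
def IsIntegral (k : Type u) {H : Type v} [Field k] [Ring H] [HopfAlgebra k H] (Λ : H) : Prop :=
  ∀ h : H, h * Λ = (Coalgebra.counit h : k) • Λ

/-- `S(Λ₍₂₎) Λ₍₁₎`. -/
def uElement (k : Type u) {H : Type v} [Field k] [Ring H] [HopfAlgebra k H] (Λ : H) : H :=
  LinearMap.mul' k H ((HopfAlgebra.antipode k).rTensor H
    (TensorProduct.comm k H H (Coalgebra.comul Λ)))

/-- The Sweedler power `a ↦ a₍₁₎ a₍₂₎ ⋯ a₍ₙ₎` (and `a ↦ ε(a) 1` for `n = 0`). -/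
def sweedlerPower (k : Type u) {H : Type v} [Field k] [Ring H] [HopfAlgebra k H] : ℕ → H →ₗ[k] H
  | 0 => Algebra.linearMap k H ∘ₗ Coalgebra.counit
  | n + 1 => LinearMap.mul' k H ∘ₗ (sweedlerPower k n).lTensor H ∘ₗ Coalgebra.comul

/-! ### Representations of `H`, given by algebra homomorphisms `H → End_k V` -/

/-- The character `χ_V(h) = tr(ρ_V(h))`. -/
def character (ρ : H →ₐ[k] Module.End k V) (h : H) : k := LinearMap.trace k V (ρ h)

/-- The trivial representation on `k`: `h` acts as multiplication by `ε(h)`. -/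
def trivialRep (k : Type u) (H : Type v) [Field k] [Ring H] [HopfAlgebra k H] :
    H →ₐ[k] Module.End k k :=
  (Algebra.lmul k k).comp (Bialgebra.counitAlgHom k H)

/-- The tensor product representation: `h (x ⊗ y) = h₍₁₎ x ⊗ h₍₂₎ y`. -/
def tensorRep (ρ : H →ₐ[k] Module.End k V) (σ : H →ₐ[k] Module.End k W) :
    H →ₐ[k] Module.End k (V ⊗[k] W) :=
  (Module.endTensorEndAlgHom (R := k) (S := k) (A := k)).comp
    ((Algebra.TensorProduct.map ρ σ).comp (Bialgebra.comulAlgHom k H))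

/-- The dual representation: `(h f)(x) = f (S(h) x)`. -/
def dualRep (ρ : H →ₐ[k] Module.End k V) : H →ₐ[k] Module.End k (Module.Dual k V) :=
  AlgHom.ofLinearMap
    { toFun := fun h => Module.Dual.transpose (R := k) (ρ (HopfAlgebra.antipode k h))
      map_add' := fun a b => by simp
      map_smul' := fun c a => by simp }
    (by ext; simp [Module.Dual.transpose])
    (fun a b => by ext f x; simp [HopfAlgebra.antipode_mul_antidistrib, Module.Dual.transpose])

@[simp] lemma dualRep_apply (ρ : H →ₐ[k] Module.End k V) (h : H) (f : Module.Dual k V) (x : V) :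
    dualRep ρ h f x = f (ρ (HopfAlgebra.antipode k h) x) := rfl

/-- `V ⊗ V^{⊗ n} ≃ V^{⊗ (n+1)}`, `x ⊗ (x₁ ⊗ ⋯ ⊗ xₙ) ↦ x ⊗ x₁ ⊗ ⋯ ⊗ xₙ`. -/
def consEquiv (k : Type u) (V : Type w₁) [Field k] [AddCommMonoid V] [Module k V] (n : ℕ) :
    V ⊗[k] (⨂[k]^n V) ≃ₗ[k] (⨂[k]^(n + 1) V) :=
  TensorProduct.congr (PiTensorProduct.subsingletonEquiv (R := k) (s := fun _ : Fin 1 => V) 0).symm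
      (LinearEquiv.refl k _) ≪≫ₗ TensorPower.mulEquiv ≪≫ₗ TensorPower.cast k V (Nat.add_comm 1 n)

/-- `V^{⊗ n} ⊗ V ≃ V^{⊗ (n+1)}`, `(x₁ ⊗ ⋯ ⊗ xₙ) ⊗ x ↦ x₁ ⊗ ⋯ ⊗ xₙ ⊗ x`. -/
def snocEquiv (k : Type u) (V : Type w₁) [Field k] [AddCommMonoid V] [Module k V] (n : ℕ) :
    (⨂[k]^n V) ⊗[k] V ≃ₗ[k] (⨂[k]^(n + 1) V) :=
  TensorProduct.congr (LinearEquiv.refl k _)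
      (PiTensorProduct.subsingletonEquiv (R := k) (s := fun _ : Fin 1 => V) 0).symm ≪≫ₗ
    TensorPower.mulEquiv

lemma consEquiv_tmul (n : ℕ) (x : V) (a : Fin n → V) :
    consEquiv k V n (x ⊗ₜ PiTensorProduct.tprod k a) =
      PiTensorProduct.tprod k (Fin.cons x a : Fin (n + 1) → V) := by
  have hx : (PiTensorProduct.subsingletonEquiv (R := k) (s := fun _ : Fin 1 => V) 0).symm x =
      PiTensorProduct.tprod k (fun _ : Fin 1 => x) := by
    rw [LinearEquiv.symm_apply_eq, PiTensorProduct.subsingletonEquiv_apply_tprod]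
  simp only [consEquiv, LinearEquiv.trans_apply, TensorProduct.congr_tmul, LinearEquiv.refl_apply, hx]
  have := TensorPower.tprod_mul_tprod k (fun _ : Fin 1 => x) a
  rw [TensorPower.gMul_def] at this
  rw [this, TensorPower.cast_tprod]
  congr 1
  ext i
  refine Fin.cases ?_ (fun j => ?_) i
  · simp [Fin.append, Fin.addCases]
  · simp only [Fin.append, Fin.addCases, Function.comp_apply, Fin.cons_succ]
    simp
    rfl

lemma snocEquiv_tmul (n : ℕ) (x : V) (a : Fin n → V) :
    snocEquiv k V n (PiTensorProduct.tprod k a ⊗ₜ x) =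
      PiTensorProduct.tprod k (Fin.snoc a x : Fin (n + 1) → V) := by
  have hx : (PiTensorProduct.subsingletonEquiv (R := k) (s := fun _ : Fin 1 => V) 0).symm x =
      PiTensorProduct.tprod k (fun _ : Fin 1 => x) := by
    rw [LinearEquiv.symm_apply_eq, PiTensorProduct.subsingletonEquiv_apply_tprod]
  simp only [snocEquiv, LinearEquiv.trans_apply, TensorProduct.congr_tmul, LinearEquiv.refl_apply, hx]
  have := TensorPower.tprod_mul_tprod k a (fun _ : Fin 1 => x)
  rw [TensorPower.gMul_def] at this
  rw [this, Fin.append_right_eq_snoc]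

/-- The representation `V^{⊗ n}`: `h (x₁ ⊗ ⋯ ⊗ xₙ) = h₍₁₎ x₁ ⊗ ⋯ ⊗ h₍ₙ₎ xₙ`; for `n = 0` it is
the trivial representation. -/
def powerRep (ρ : H →ₐ[k] Module.End k V) : (n : ℕ) → H →ₐ[k] Module.End k (⨂[k]^n V)
  | 0 => ((TensorPower.algebraMap₀ (R := k) (M := V)).conjAlgEquiv k).toAlgHom.comp (trivialRep k H)
  | n + 1 => ((consEquiv k V n).conjAlgEquiv k).toAlgHom.comp (tensorRep ρ (powerRep ρ n))

/-! ### Morphisms of representations -/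

/-- `Hom_H(V, W)`. -/
def homH (ρ : H →ₐ[k] Module.End k V) (σ : H →ₐ[k] Module.End k W) : Submodule k (V →ₗ[k] W) where
  carrier := {f | ∀ h : H, f ∘ₗ ρ h = σ h ∘ₗ f}
  add_mem' := fun {f g} hf hg h => by rw [LinearMap.add_comp, hf h, hg h, LinearMap.comp_add]
  zero_mem' := fun h => by simp
  smul_mem' := fun c f hf h => by rw [LinearMap.smul_comp, hf h, LinearMap.comp_smul]

section

variable {ρ : H →ₐ[k] Module.End k V} {σ : H →ₐ[k] Module.End k W}
  {τ : H →ₐ[k] Module.End k X} {υ : H →ₐ[k] Module.End k Y}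

lemma mem_homH {f : V →ₗ[k] W} : f ∈ homH ρ σ ↔ ∀ h x, f (ρ h x) = σ h (f x) :=
  forall_congr' fun _ => LinearMap.ext_iff

lemma comp_mem {g : W →ₗ[k] X} {f : V →ₗ[k] W} (hg : g ∈ homH σ τ) (hf : f ∈ homH ρ σ) :
    g ∘ₗ f ∈ homH ρ τ := by
  rw [mem_homH] at *
  intro h x
  simp [hf, hg]

lemma symm_mem {e : V ≃ₗ[k] W} (he : e.toLinearMap ∈ homH ρ σ) :
    e.symm.toLinearMap ∈ homH σ ρ := by
  rw [mem_homH] at *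
  intro h x
  apply e.injective
  simpa using (he h (e.symm x)).symm

lemma id_mem : LinearMap.id ∈ homH ρ ρ := fun _ => rfl

lemma tensorRep_tmul (h : H) (x : V) (y : W) : tensorRep ρ σ h (x ⊗ₜ y) =
    ∑ i ∈ (ℛ k h).index, ρ ((ℛ k h).left i) x ⊗ₜ[k] σ ((ℛ k h).right i) y := by
  simp only [tensorRep, AlgHom.comp_apply, Bialgebra.comulAlgHom_apply]
  conv_lhs => rw [← (ℛ k h).eq]
  simp only [map_sum, LinearMap.sum_apply, Algebra.TensorProduct.map_tmul]
  rfl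

lemma map_mem {f : V →ₗ[k] W} {g : X →ₗ[k] Y} (hf : f ∈ homH ρ σ) (hg : g ∈ homH τ υ) :
    TensorProduct.map f g ∈ homH (tensorRep ρ τ) (tensorRep σ υ) := by
  rw [mem_homH] at hf hg
  intro h
  ext x y
  simp [tensorRep_tmul, hf, hg, map_sum]

lemma assoc_mem : (TensorProduct.assoc k V W X).toLinearMap ∈
    homH (tensorRep (tensorRep ρ σ) τ) (tensorRep ρ (tensorRep σ τ)) := by
  intro h
  ext x y z
  have key := congrArg (TensorProduct.map (ρ.toLinearMap.flip x)
    (TensorProduct.map (σ.toLinearMap.flip y) (τ.toLinearMap.flip z)))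
    (Coalgebra.sum_tmul_tmul_eq (ℛ k h) (fun i => ℛ k ((ℛ k h).left i))
      (fun i => ℛ k ((ℛ k h).right i)))
  simpa [tensorRep_tmul, map_sum, TensorProduct.sum_tmul, TensorProduct.tmul_sum] using key

lemma lid_mem : (TensorProduct.lid k V).toLinearMap ∈
    homH (tensorRep (trivialRep k H) ρ) ρ := by
  intro h
  ext x
  have key := congrArg (fun t => ρ t x) (Coalgebra.sum_counit_smul (ℛ k h))
  simpa [tensorRep_tmul, trivialRep, map_sum] using key

lemma sum_smul_counit (h : H) :
    ∑ i ∈ (ℛ k h).index, (counit (R := k) ((ℛ k h).right i)) • (ℛ k h).left i = h := by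
  have key := congrArg (TensorProduct.rid k H) (Coalgebra.sum_tmul_counit_eq (ℛ k h))
  simpa only [map_sum, TensorProduct.rid_tmul, one_smul] using key

lemma rid_mem : (TensorProduct.rid k V).toLinearMap ∈
    homH (tensorRep ρ (trivialRep k H)) ρ := by
  intro h
  ext x
  have key := congrArg (fun t => ρ t x) (sum_smul_counit (k := k) h)
  simpa [tensorRep_tmul, trivialRep, map_sum] using key

lemma ev_mem : contractLeft k V ∈ homH (tensorRep (dualRep ρ) ρ) (trivialRep k H) := by
  intro h
  ext f x
  have key := congrArg (fun t => f (ρ t x)) (HopfAlgebra.sum_antipode_mul_eq_smul (ℛ k h))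
  simpa [tensorRep_tmul, trivialRep, map_sum] using key

lemma consEquiv_mem (n : ℕ) : (consEquiv k V n).toLinearMap ∈
    homH (tensorRep ρ (powerRep ρ n)) (powerRep ρ (n + 1)) := by
  rw [mem_homH]
  intro h x
  simp [powerRep]

lemma algebraMap₀_mem : (TensorPower.algebraMap₀ (R := k) (M := V)).toLinearMap ∈
    homH (trivialRep k H) (powerRep ρ 0) := by
  rw [mem_homH]
  intro h x
  simp [powerRep]

lemma snocEquiv_mem (n : ℕ) : (snocEquiv k V n).toLinearMap ∈
    homH (tensorRep (powerRep ρ n) ρ) (powerRep ρ (n + 1)) := by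
  induction n with
  | zero =>
    have e : (snocEquiv k V 0).toLinearMap = (consEquiv k V 0).toLinearMap ∘ₗ
        TensorProduct.map LinearMap.id (TensorPower.algebraMap₀ (R := k) (M := V)).toLinearMap ∘ₗ
        (TensorProduct.rid k V).symm.toLinearMap ∘ₗ (TensorProduct.lid k V).toLinearMap ∘ₗ
        TensorProduct.map (TensorPower.algebraMap₀ (R := k) (M := V)).symm.toLinearMap
          LinearMap.id := by
      ext a x
      have ha : TensorPower.algebraMap₀ (R := k) (M := V) 1 = PiTensorProduct.tprod k a := by
        rw [TensorPower.algebraMap₀_one, TensorPower.gOne_def]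
        congr 1
        exact Subsingleton.elim _ _
      have ha' : (TensorPower.algebraMap₀ (R := k) (M := V)).symm (PiTensorProduct.tprod k a) = 1 := by
        rw [← ha, LinearEquiv.symm_apply_apply]
      have hs : (Fin.snoc a x : Fin 1 → V) = Fin.cons x a := by
        ext i
        rw [Fin.fin_one_eq_zero i]
        simp [Fin.snoc]
      simp [snocEquiv_tmul, ha', ha, consEquiv_tmul, hs]
    rw [e]
    exact comp_mem (consEquiv_mem 0) (comp_mem (map_mem id_mem algebraMap₀_mem)
      (comp_mem (symm_mem rid_mem) (comp_mem lid_mem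
        (map_mem (symm_mem algebraMap₀_mem) id_mem))))
  | succ n ih =>
    have e : (snocEquiv k V (n + 1)).toLinearMap ∘ₗ
          TensorProduct.map (consEquiv k V n).toLinearMap LinearMap.id =
        (consEquiv k V (n + 1)).toLinearMap ∘ₗ
        TensorProduct.map LinearMap.id (snocEquiv k V n).toLinearMap ∘ₗ
        (TensorProduct.assoc k V (⨂[k]^n V) V).toLinearMap := by
      ext x a y
      simp [snocEquiv_tmul, consEquiv_tmul, Fin.cons_snoc_eq_snoc_cons]
    have e' : (snocEquiv k V (n + 1)).toLinearMap = ((consEquiv k V (n + 1)).toLinearMap ∘ₗ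
        TensorProduct.map LinearMap.id (snocEquiv k V n).toLinearMap ∘ₗ
        (TensorProduct.assoc k V (⨂[k]^n V) V).toLinearMap) ∘ₗ
        TensorProduct.map (consEquiv k V n).symm.toLinearMap LinearMap.id := by
      rw [← e, LinearMap.comp_assoc, ← TensorProduct.map_comp]
      simp
    rw [e']
    exact comp_mem (comp_mem (consEquiv_mem (n + 1)) (comp_mem (map_mem id_mem ih) assoc_mem))
      (map_mem (symm_mem (consEquiv_mem n)) id_mem)

end

/-! ### The operator `E_V^n` -/

/-- `V* ⊗ (V^{⊗ (n+1)} ⊗ V**) → V^{⊗ n} ⊗ V**`, evaluating the functional in `V*` at the first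
tensor factor of `V^{⊗ (n+1)}`. -/
def evFirst (k : Type u) (V : Type w₁) (Z : Type w₂) [Field k] [AddCommMonoid V] [Module k V]
    [AddCommMonoid Z] [Module k Z] (n : ℕ) :
    Module.Dual k V ⊗[k] ((⨂[k]^(n + 1) V) ⊗[k] Z) →ₗ[k] (⨂[k]^n V) ⊗[k] Z :=
  TensorProduct.map
      ((TensorProduct.lid k _).toLinearMap ∘ₗ
        TensorProduct.map (contractLeft k V) LinearMap.id ∘ₗ
        (TensorProduct.assoc k (Module.Dual k V) V (⨂[k]^n V)).symm.toLinearMap ∘ₗ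
        TensorProduct.map LinearMap.id (consEquiv k V n).symm.toLinearMap)
      LinearMap.id ∘ₗ
    (TensorProduct.assoc k (Module.Dual k V) (⨂[k]^(n + 1) V) Z).symm.toLinearMap

lemma evFirst_mem {ρ : H →ₐ[k] Module.End k V} {σ : H →ₐ[k] Module.End k W} (n : ℕ) :
    evFirst k V W n ∈ homH (tensorRep (dualRep ρ) (tensorRep (powerRep ρ (n + 1)) σ))
      (tensorRep (powerRep ρ n) σ) :=
  comp_mem (map_mem (comp_mem lid_mem (comp_mem (map_mem ev_mem id_mem)
    (comp_mem (symm_mem assoc_mem) (map_mem id_mem (symm_mem (consEquiv_mem n)))))) id_mem)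
    (symm_mem assoc_mem)

section

variable {V : Type w₁} [AddCommGroup V] [Module k V] [FiniteDimensional k V]

lemma coev_mem (ρ : H →ₐ[k] Module.End k V) :
    coevaluation k V ∈ homH (trivialRep k H) (tensorRep ρ (dualRep ρ)) := by
  intro h
  ext
  let Φ : V ⊗[k] Module.Dual k V →ₗ[k] V →ₗ[k] V :=
    dualTensorHom k V V ∘ₗ (TensorProduct.comm k V (Module.Dual k V)).toLinearMap
  have hΦ : Function.Injective Φ :=
    (dualTensorHomEquiv k V V).injective.comp (TensorProduct.comm k _ _).injective
  apply hΦ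
  let b := Module.Basis.ofVectorSpace k V
  have hb : ∀ y : V, ∑ i, b.repr y i • b i = y := fun y => b.sum_repr y
  ext x
  have key := congrArg (fun t => ρ t x) (HopfAlgebra.sum_mul_antipode_eq_smul (ℛ k h))
  have key2 : ∑ i ∈ (ℛ k h).index, ρ ((ℛ k h).left i)
      (∑ j, b.repr (ρ (HopfAlgebra.antipode k ((ℛ k h).right i)) x) j • b j) =
      (counit h : k) • ∑ j, b.repr x j • b j := by
    simp only [hb]
    simpa [map_sum] using key
  have htriv : trivialRep k H h (1 : k) = (counit h : k) • (1 : k) := rfl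
  rw [LinearMap.comp_apply, LinearMap.comp_apply, htriv, map_smul, coevaluation_apply_one]
  simp only [Φ, LinearMap.comp_apply, coevaluation_apply_one, tensorRep_tmul, map_sum, map_smul,
    LinearMap.sum_apply, LinearMap.smul_apply, LinearEquiv.coe_coe, TensorProduct.comm_tmul,
    dualTensorHom_apply, dualRep_apply, Module.Basis.coord_apply]
  simp only [map_sum, map_smul, Finset.smul_sum] at key2
  rw [Finset.sum_comm, key2, Finset.smul_sum]

/-- For a unit `u` of `H`, the `k`-linear isomorphism `V ≃ V**` with `j(x)(f) = f(u x)`. -/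
def jEquiv (ρ : H →ₐ[k] Module.End k V) (u : Hˣ) :
    V ≃ₗ[k] Module.Dual k (Module.Dual k V) :=
  LinearEquiv.ofLinearMap (ρ u) (ρ ↑u⁻¹)
      (by rw [← Module.End.mul_eq_comp, ← map_mul]; simp [Module.End.one_eq_id])
      (by rw [← Module.End.mul_eq_comp, ← map_mul]; simp [Module.End.one_eq_id]) ≪≫ₗ
    Module.evalEquiv k V

@[simp] lemma jEquiv_apply (ρ : H →ₐ[k] Module.End k V) (u : Hˣ) (x : V) (f : Module.Dual k V) :
    jEquiv ρ u x f = f (ρ u x) := rfl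

/-- If `S²(h) = u h u⁻¹` for all `h`, then `j : V → V**` is a morphism of representations. -/
lemma jEquiv_mem (ρ : H →ₐ[k] Module.End k V) (u : Hˣ)
    (hu : ∀ h : H, HopfAlgebra.antipode k (HopfAlgebra.antipode k h) = u * h * ↑u⁻¹) :
    (jEquiv ρ u).toLinearMap ∈ homH ρ (dualRep (dualRep ρ)) := by
  rw [mem_homH]
  intro h x
  ext f
  simp only [LinearEquiv.coe_coe, jEquiv_apply, dualRep_apply, hu]
  rw [← Module.End.mul_apply, ← Module.End.mul_apply, ← map_mul, ← map_mul]
  simp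

/-- The composite
`k → V* ⊗ V** = V* ⊗ (k ⊗ V**) → V* ⊗ (V^{⊗ (n+1)} ⊗ V**) → V^{⊗ n} ⊗ V** → V^{⊗ (n+1)}`
of the coevaluation of `V*`, of `id ⊗ f ⊗ id`, of the evaluation on the first tensor factor and of
`id ⊗ j⁻¹`. -/
def rotate (ρ : H →ₐ[k] Module.End k V) (u : Hˣ) (n : ℕ) (f : k →ₗ[k] (⨂[k]^(n + 1) V)) :
    k →ₗ[k] (⨂[k]^(n + 1) V) :=
  (snocEquiv k V n).toLinearMap ∘ₗ
    TensorProduct.map LinearMap.id (jEquiv ρ u).symm.toLinearMap ∘ₗ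
    evFirst k V (Module.Dual k (Module.Dual k V)) n ∘ₗ
    TensorProduct.map LinearMap.id (TensorProduct.map f LinearMap.id) ∘ₗ
    TensorProduct.map LinearMap.id (TensorProduct.lid k _).symm.toLinearMap ∘ₗ
    coevaluation k (Module.Dual k V)

lemma rotate_mem (ρ : H →ₐ[k] Module.End k V) (u : Hˣ)
    (hu : ∀ h : H, HopfAlgebra.antipode k (HopfAlgebra.antipode k h) = u * h * ↑u⁻¹)
    (n : ℕ) {f : k →ₗ[k] (⨂[k]^(n + 1) V)} (hf : f ∈ homH (trivialRep k H) (powerRep ρ (n + 1))) :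
    rotate ρ u n f ∈ homH (trivialRep k H) (powerRep ρ (n + 1)) :=
  comp_mem (snocEquiv_mem n) (comp_mem (map_mem id_mem (symm_mem (jEquiv_mem ρ u hu)))
    (comp_mem (evFirst_mem n) (comp_mem (map_mem id_mem (map_mem hf id_mem))
      (comp_mem (map_mem id_mem (symm_mem lid_mem)) (coev_mem _)))))

/-- The operator `E_V^{n+1}` on `Hom_H(k, V^{⊗ (n+1)})`. -/
def fsOperator (ρ : H →ₐ[k] Module.End k V) (u : Hˣ)
    (hu : ∀ h : H, HopfAlgebra.antipode k (HopfAlgebra.antipode k h) = u * h * ↑u⁻¹) (n : ℕ) :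
    homH (trivialRep k H) (powerRep ρ (n + 1)) →ₗ[k] homH (trivialRep k H) (powerRep ρ (n + 1)) where
  toFun f := ⟨rotate ρ u n f, rotate_mem ρ u hu n f.2⟩
  map_add' f g := by
    ext1
    simp [rotate, TensorProduct.map_add_left, TensorProduct.map_add_right, LinearMap.add_comp,
      LinearMap.comp_add]
  map_smul' c f := by
    ext1
    simp [rotate, TensorProduct.map_smul_left, TensorProduct.map_smul_right, LinearMap.smul_comp,
      LinearMap.comp_smul]

/-- The indicator `tr(E_V^n)` for `n ≥ 1`. -/
def fsIndicator (ρ : H →ₐ[k] Module.End k V) (u : Hˣ)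
    (hu : ∀ h : H, HopfAlgebra.antipode k (HopfAlgebra.antipode k h) = u * h * ↑u⁻¹) :
    (n : ℕ) → 1 ≤ n → k
  | n + 1, _ => LinearMap.trace k _ (fsOperator ρ u hu n)

end

end

end HopfFS

/-! Write `u = S(Λ₍₂₎) Λ₍₁₎`. Semisimplicity splits off the trivial module from `H`, giving a
two-sided integral `Λ₀` with `ε(Λ₀) = 1` of which every integral is a multiple; hence `u h = S²(h)
u` (`IsIntegral.uElement_mul`).

If `u` were not a unit, its right annihilator, a left ideal by this relation, would contain a simple
module `V` on which `u` acts as `0`. But `tr_V(u) = ε(Λ) dim V` with `ε(Λ) ≠ 0`, so `p ∣ dim V`,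
impossible since Burnside gives `(dim V)² ≤ dim H < p²` (and impossible for `p = 0`).

For the formula, `Hom_H(k, V^{⊗n})` is the space of invariants of `V^{⊗n}`. On it `E_V^n` is `x₁ ⊗ ⋯
⊗ xₙ ↦ x₂ ⊗ ⋯ ⊗ xₙ ⊗ u₀⁻¹ x₁` (`rotate_apply_one`), and `Λ₀` projects onto it, so `tr(E_V^n)` is the
trace of this rotation composed with `Λ₀` on all of `V^{⊗n}`. The trace of a cyclic permutation
composed with operators on the factors is the trace on `V` of their product
(`trace_twistedRotation`), which yields `χ_V(u₀⁻¹ Λ₀₍₁₎ ⋯ Λ₀₍ₙ₎)`. Rescaling `Λ₀` multiplies `u` and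
the Sweedler power by the same scalar, which cancels. -/

namespace HopfFS

/-! ### Integrals in semisimple Hopf algebras. -/

/-- A semisimple algebra with an augmentation `ε` contains `Λ` with `ε Λ = 1` and `h Λ = ε(h) Λ`. -/
lemma exists_left_integral_of_isSemisimpleRing {k A : Type*} [Field k] [Ring A] [Algebra k A]
    [IsSemisimpleRing A] (ε : A →ₐ[k] k) : ∃ Λ : A, ε Λ = 1 ∧ ∀ h, h * Λ = ε h • Λ := by
  obtain ⟨J, hJ⟩ := exists_isCompl (RingHom.ker ε : Submodule A A)
  have h1 : (1 : A) ∈ (RingHom.ker ε : Submodule A A) ⊔ J := by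
    rw [hJ.sup_eq_top]; trivial
  obtain ⟨a, ha, Λ, hΛ, h⟩ := Submodule.mem_sup.mp h1
  have hε : ε Λ = 1 := by
    have ha' : ε a = 0 := ha
    have := congrArg ε h
    simpa [ha'] using this
  refine ⟨Λ, hε, fun b => ?_⟩
  -- `b - ε(b)` lies in `ker ε`, so its product with `Λ` does too; the product also stays in the
  -- left ideal `J`, which meets `ker ε` trivially.
  have hmem : (b - algebraMap k A (ε b)) * Λ ∈ (RingHom.ker ε : Submodule A A) ⊓ J :=
    ⟨by change ε _ = 0; simp, J.smul_mem (b - algebraMap k A (ε b)) hΛ⟩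
  rw [hJ.inf_eq_bot, Submodule.mem_bot, sub_mul, sub_eq_zero] at hmem
  rw [hmem, Algebra.smul_def]

/-- The opposite-side version of `exists_left_integral_of_isSemisimpleRing`. -/
lemma exists_right_integral_of_isSemisimpleRing {k A : Type*} [Field k] [Ring A] [Algebra k A]
    [IsSemisimpleRing A] (ε : A →ₐ[k] k) : ∃ Λ : A, ε Λ = 1 ∧ ∀ h, Λ * h = ε h • Λ := by
  -- Semisimplicity is left-right symmetric, so the left version applies to the opposite algebra.
  obtain ⟨Λ, h1, h2⟩ := exists_left_integral_of_isSemisimpleRing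
    (ε.fromOpposite fun x y => Commute.all (ε x) (ε y))
  refine ⟨Λ.unop, h1, fun h => MulOpposite.op_injective ?_⟩
  simpa using h2 (MulOpposite.op h)

section Integrals

lemma IsIntegral.counit_eq_one {k H : Type*} [Field k] [Ring H] [HopfAlgebra k H] {Λ : H} (hΛ : IsIntegral k Λ) (h0 : Λ ≠ 0)
    (hi : IsIdempotentElem Λ) : counit (R := k) Λ = 1 := by
  have h : counit (R := k) Λ • Λ = (1 : k) • Λ := by rw [← hΛ Λ, hi.eq, one_smul]
  exact smul_left_injective k h0 h

variable {k H : Type*} [Field k] [Ring H] [HopfAlgebra k H] [IsSemisimpleRing H]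

/-- A semisimple Hopf algebra has a two-sided integral `Λ₀` with `ε(Λ₀) = 1`, and every integral is
a multiple of it. -/
lemma exists_normalized_integral : ∃ Λ₀ : H, IsIntegral k Λ₀ ∧ counit (R := k) Λ₀ = 1 ∧
    (∀ h : H, Λ₀ * h = counit (R := k) h • Λ₀) ∧
    ∀ Λ : H, IsIntegral k Λ → Λ = counit (R := k) Λ • Λ₀ := by
  obtain ⟨R, hR, hR'⟩ := exists_right_integral_of_isSemisimpleRing (Bialgebra.counitAlgHom k H)
  obtain ⟨L, hL, hL'⟩ := exists_left_integral_of_isSemisimpleRing (Bialgebra.counitAlgHom k H)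
  simp only [Bialgebra.counitAlgHom_apply] at *
  -- The product `R * Λ` is evaluated twice, with `R` as a right integral and with `Λ` as a left
  -- one.
  have key : ∀ Λ : H, IsIntegral k Λ → Λ = counit (R := k) Λ • R := fun Λ hΛ => by
    rw [← hR' Λ, hΛ R, hR, one_smul]
  have hLR : L = R := by rw [key L hL', hL, one_smul]
  subst hLR
  exact ⟨L, hL', hL, hR', key⟩

lemma IsIntegral.counit_ne_zero {Λ : H} (hΛ : IsIntegral k Λ) (h0 : Λ ≠ 0) :
    counit (R := k) Λ ≠ 0 := by
  obtain ⟨Λ₀, -, -, -, h⟩ := exists_normalized_integral (k := k) (H := H)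
  intro h'
  exact h0 (by rw [h Λ hΛ, h', zero_smul])

lemma existsUnique_idempotent_integral (k H : Type*) [Field k] [Ring H] [HopfAlgebra k H]
    [IsSemisimpleRing H] : ∃! Λ₀ : H, IsIntegral k Λ₀ ∧ Λ₀ ≠ 0 ∧ IsIdempotentElem Λ₀ := by
  obtain ⟨Λ₀, h1, h2, -, h⟩ := exists_normalized_integral (k := k) (H := H)
  refine ⟨Λ₀, ⟨h1, ?_, ?_⟩, ?_⟩
  · rintro rfl
    simp at h2
  · rw [IsIdempotentElem, h1, h2, one_smul]
  · rintro Λ ⟨h3, h4, h5⟩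
    rw [h Λ h3, h3.counit_eq_one h4 h5, one_smul]

/-- Unimodularity: left integrals are multiples of a two-sided one. -/
lemma IsIntegral.mul_right {Λ : H} (hΛ : IsIntegral k Λ) (h : H) :
    Λ * h = counit (R := k) h • Λ := by
  obtain ⟨Λ₀, -, -, h1, h2⟩ := exists_normalized_integral (k := k) (H := H)
  rw [h2 Λ hΛ, smul_mul_assoc, h1, smul_comm]

end Integrals

/-! ### The element `u` and the square of the antipode. -/

section UElement

variable {k H : Type*} [Field k] [Ring H] [HopfAlgebra k H]

variable (k H) in
/-- The linear map `a ⊗ b ↦ S(b) a`. -/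
noncomputable def antipodeSwapMul : H ⊗[k] H →ₗ[k] H :=
  LinearMap.mul' k H ∘ₗ (HopfAlgebra.antipode k).rTensor H ∘ₗ
    (TensorProduct.comm k H H).toLinearMap

@[simp] lemma antipodeSwapMul_tmul (a b : H) :
    antipodeSwapMul k H (a ⊗ₜ b) = HopfAlgebra.antipode k b * a := rfl

lemma antipodeSwapMul_comul (Λ : H) : antipodeSwapMul k H (comul Λ) = uElement k Λ := rfl

lemma uElement_smul (c : k) (Λ : H) : uElement k (c • Λ) = c • uElement k Λ := by
  simp only [← antipodeSwapMul_comul, map_smul]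

/-- Together with `antipodeSwapMul_mul_right`, this turns `u h = S²(h) u` into an identity in `H ⊗
H`, namely `Δ(Λ)(h ⊗ 1) = Δ(Λ)(1 ⊗ S(h))`. -/
lemma antipodeSwapMul_mul_left (t : H ⊗[k] H) (h : H) :
    antipodeSwapMul k H (t * (h ⊗ₜ 1)) = antipodeSwapMul k H t * h := by
  induction t with
  | zero => simp
  | add x y hx hy => rw [add_mul, map_add, hx, hy, map_add, add_mul]
  | tmul a b => simp [mul_assoc]

lemma antipodeSwapMul_mul_right (t : H ⊗[k] H) (h : H) :
    antipodeSwapMul k H (t * (1 ⊗ₜ h)) =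
      HopfAlgebra.antipode k h * antipodeSwapMul k H t := by
  induction t with
  | zero => simp
  | add x y hx hy => rw [add_mul, map_add, hx, hy, map_add, mul_add]
  | tmul a b => simp [HopfAlgebra.antipode_mul_antidistrib, mul_assoc]

/-- `h₍₁₎ ⊗ h₍₂₎ S(h₍₃₎) = h ⊗ 1`. -/
lemma sum_comul_mul_antipode (h : H) :
    ∑ i ∈ (ℛ k h).index, comul (R := k) ((ℛ k h).left i) *
      (1 ⊗ₜ HopfAlgebra.antipode k ((ℛ k h).right i)) = h ⊗ₜ[k] (1 : H) := by
  -- Coassociativity pushed through `a ⊗ b ⊗ c ↦ a ⊗ b S(c)`; the antipode axiom then collapses the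
  -- right-hand side.
  have key := congrArg (LinearMap.lTensor H
      (LinearMap.mul' k H ∘ₗ (HopfAlgebra.antipode k).lTensor H))
    (Coalgebra.sum_tmul_tmul_eq (ℛ k h) (fun i => ℛ k ((ℛ k h).left i))
      (fun i => ℛ k ((ℛ k h).right i)))
  simp only [map_sum, LinearMap.lTensor_tmul, LinearMap.comp_apply, LinearMap.mul'_apply] at key
  have e1 : ∀ i, comul (R := k) ((ℛ k h).left i) *
      (1 ⊗ₜ HopfAlgebra.antipode k ((ℛ k h).right i)) =
      ∑ j ∈ (ℛ k ((ℛ k h).left i)).index, (ℛ k ((ℛ k h).left i)).left j ⊗ₜ[k]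
        ((ℛ k ((ℛ k h).left i)).right j * HopfAlgebra.antipode k ((ℛ k h).right i)) := fun i => by
    conv_lhs => rw [← (ℛ k ((ℛ k h).left i)).eq]
    simp [Finset.sum_mul]
  rw [Finset.sum_congr rfl fun i _ => e1 i, key]
  simp only [← TensorProduct.tmul_sum, HopfAlgebra.sum_mul_antipode_eq_smul]
  conv_rhs => rw [← sum_smul_counit (k := k) h]
  simp [TensorProduct.sum_tmul, TensorProduct.smul_tmul]

/-- For a semisimple Hopf algebra, `u h = S²(h) u` where `u = S(Λ₍₂₎) Λ₍₁₎`. -/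
lemma IsIntegral.uElement_mul [IsSemisimpleRing H] {Λ : H} (hΛ : IsIntegral k Λ) (h : H) :
    uElement k Λ * h =
      HopfAlgebra.antipode k (HopfAlgebra.antipode k h) * uElement k Λ := by
  rw [← antipodeSwapMul_comul, ← antipodeSwapMul_mul_left, ← antipodeSwapMul_mul_right]
  congr 1
  -- With `h ⊗ 1 = ∑ Δ(h₍₁₎)(1 ⊗ S(h₍₂₎))`, each `Δ(Λ) Δ(h₍₁₎) = Δ(Λ h₍₁₎)` equals `ε(h₍₁₎) Δ(Λ)`,
  -- and the counit axiom leaves `Δ(Λ)(1 ⊗ S(h))`.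
  conv_lhs => rw [← sum_comul_mul_antipode h]
  rw [Finset.mul_sum]
  simp only [← mul_assoc, ← Bialgebra.comul_mul, hΛ.mul_right, map_smul, smul_mul_assoc]
  simp only [← mul_smul_comm, ← Finset.mul_sum, ← TensorProduct.tmul_smul,
    ← TensorProduct.tmul_sum, ← map_smul, ← map_sum, Coalgebra.sum_counit_smul]

end UElement

/-! ### The trace of `u` on a representation. -/

section Trace

variable {k H V : Type*} [Field k] [Ring H] [HopfAlgebra k H] [AddCommGroup V] [Module k V]

/-- `χ_V(S(Λ₍₂₎) Λ₍₁₎) = ε(Λ) dim V`. -/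
lemma character_uElement [FiniteDimensional k V] (ρ : H →ₐ[k] Module.End k V) (Λ : H) :
    character ρ (uElement k Λ) = counit (R := k) Λ * Module.finrank k V := by
  -- Under a trace `S(b) a` may be replaced by `a S(b)`, and the antipode axiom evaluates the latter
  -- on `Δ(Λ)`.
  have h1 : LinearMap.trace k V ∘ₗ ρ.toLinearMap ∘ₗ antipodeSwapMul k H =
      LinearMap.trace k V ∘ₗ ρ.toLinearMap ∘ₗ LinearMap.mul' k H ∘ₗ
        (HopfAlgebra.antipode k).lTensor H := by
    ext a b
    simp [LinearMap.trace_mul_comm]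
  have h2 := LinearMap.congr_fun h1 (comul Λ)
  simp only [LinearMap.comp_apply, HopfAlgebra.mul_antipode_lTensor_comul_apply,
    antipodeSwapMul_comul, AlgHom.toLinearMap_apply, AlgHom.commutes] at h2
  rw [character, h2, Module.algebraMap_end_eq_smul_id, map_smul, LinearMap.trace_id, smul_eq_mul]

end Trace

/-! ### Dimensions of simple modules. -/

section Burnside

variable {k A V : Type*} [Field k] [IsAlgClosed k] [Ring A] [Algebra k A]
  [AddCommGroup V] [Module k V] [Module A V] [IsScalarTower k A V] [IsSimpleModule A V]
  [FiniteDimensional k V]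

/-- Burnside's theorem. -/
lemma lsmul_surjective_of_isSimpleModule :
    Function.Surjective (Algebra.lsmul k k V : A →ₐ[k] Module.End k V) := by
  classical
  intro f
  -- By Schur's lemma `End_A(V) = k`, so every `k`-linear `f` is `End_A(V)`-linear and the density
  -- theorem matches it with some `r` on a basis.
  let f' : Module.End (Module.End A V) V :=
    { toFun := f
      map_add' := f.map_add
      map_smul' := fun g x => by
        obtain ⟨c, rfl⟩ := (IsSimpleModule.algebraMap_end_bijective_of_isAlgClosed k).2 g
        simp }
  let b := Module.finBasis k V
  obtain ⟨r, hr⟩ := jacobson_density f' (Finset.univ.image b)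
  refine ⟨r, b.ext fun i => ?_⟩
  exact (hr (b i) (by simp)).symm

lemma finrank_sq_le_of_isSimpleModule [FiniteDimensional k A] :
    Module.finrank k V ^ 2 ≤ Module.finrank k A := by
  have := LinearMap.finrank_le_finrank_of_surjective
    (f := (Algebra.lsmul k k V : A →ₐ[k] Module.End k V).toLinearMap)
    lsmul_surjective_of_isSimpleModule
  rwa [Module.finrank_linearMap, ← sq] at this

end Burnside

/-! ### Invertibility of `u`. -/

section Unit

variable {k H : Type*} [Field k] [IsAlgClosed k] [Ring H] [HopfAlgebra k H]
  [FiniteDimensional k H] [IsSemisimpleRing H]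

lemma IsIntegral.isUnit_uElement (p : ℕ) [CharP k p]
    (hp : p = 0 ∨ Real.sqrt (Module.finrank k H) < p) {Λ : H} (hΛ : IsIntegral k Λ) (h0 : Λ ≠ 0) :
    IsUnit (uElement k Λ) := by
  -- The right annihilator of `u`; closure under left multiplication is `u c x = S²(c) u x`.
  let L : Submodule H H :=
    { carrier := {x | uElement k Λ * x = 0}
      add_mem' := fun {a b} ha hb => by
        change _ * (a + b) = 0
        rw [mul_add, show _ * a = 0 from ha, show _ * b = 0 from hb, add_zero]
      zero_mem' := mul_zero _
      smul_mem' := fun c x hx => by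
        change _ * (c * x) = 0
        rw [← mul_assoc, hΛ.uElement_mul, mul_assoc, show _ * x = 0 from hx, mul_zero] }
  rcases IsSemisimpleModule.eq_bot_or_exists_simple_le L with hL | ⟨V, hVL, hV⟩
  -- Injectivity of left multiplication by `u` implies surjectivity by finite dimension, and a
  -- one-sided inverse suffices in `H`.
  · have hinj : Function.Injective (LinearMap.mulLeft k (uElement k Λ)) := by
      rw [injective_iff_map_eq_zero]
      intro x hx
      have : x ∈ L := hx
      rwa [hL] at this
    obtain ⟨v, hv⟩ := LinearMap.surjective_of_injective hinj 1
    exact IsUnit.of_mul_eq_one v hv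
  · exfalso
    have : FiniteDimensional k V :=
      FiniteDimensional.finiteDimensional_submodule (V.restrictScalars k)
    have : Nontrivial V := IsSimpleModule.nontrivial H V
    have hzero : (Algebra.lsmul k k V : H →ₐ[k] Module.End k V) (uElement k Λ) = 0 := by
      ext x
      exact hVL x.2
    -- The zero action of `u` on `V` forces `dim V = 0` in `k`; the hypothesis on `p` is used to
    -- exclude exactly this.
    have htr := character_uElement (Algebra.lsmul k k V : H →ₐ[k] Module.End k V) Λ
    rw [character, hzero, map_zero, eq_comm, mul_eq_zero, or_iff_right (hΛ.counit_ne_zero h0),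
      CharP.cast_eq_zero_iff k p] at htr
    have hpos : 0 < Module.finrank k V := Module.finrank_pos
    have hle := finrank_sq_le_of_isSimpleModule (k := k) (A := H) (V := V)
    rcases hp with rfl | hp
    · exact hpos.ne' (Nat.eq_zero_of_zero_dvd htr)
    · have h1 : p ≤ Module.finrank k V := Nat.le_of_dvd hpos htr
      rw [Real.sqrt_lt' (lt_of_le_of_lt (Real.sqrt_nonneg _) hp)] at hp
      have h2 : Module.finrank k H < p ^ 2 := by exact_mod_cast hp
      exact absurd (Nat.pow_le_pow_left h1 2) (by omega)

end Unit

end HopfFS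

namespace HopfFS

/-! ### Traces of operators composed with a flip. -/

section CyclicTrace

variable {k V W X : Type*} [Field k]
  [AddCommGroup V] [Module k V] [FiniteDimensional k V]
  [AddCommGroup W] [Module k W] [FiniteDimensional k W]
  [AddCommGroup X] [Module k X]

/-- Linear maps on `End (V ⊗ W)` agree if they agree on the maps `f ⊗ g`. -/
lemma end_tensor_hom_ext {φ ψ : Module.End k (V ⊗[k] W) →ₗ[k] X}
    (h : ∀ (f : Module.End k V) (g : Module.End k W),
      φ (TensorProduct.map f g) = ψ (TensorProduct.map f g)) : φ = ψ := by
  have : φ ∘ₗ (homTensorHomEquiv k V W V W).toLinearMap =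
      ψ ∘ₗ (homTensorHomEquiv k V W V W).toLinearMap := by
    ext f g
    simpa [homTensorHomEquiv_apply, TensorProduct.homTensorHomMap_apply] using h f g
  exact (LinearMap.cancel_right (homTensorHomEquiv k V W V W).surjective).mp this

/-- `tr (x ⊗ y ↦ f y ⊗ g x) = tr (f g)`. -/
lemma trace_map_comp_comm (f g : Module.End k V) :
    LinearMap.trace k (V ⊗[k] V) (TensorProduct.map f g ∘ₗ (TensorProduct.comm k V V).toLinearMap) =
      LinearMap.trace k V (f ∘ₗ g) := by
  obtain ⟨a, rfl⟩ := (dualTensorHomEquiv k V V).surjective f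
  obtain ⟨b, rfl⟩ := (dualTensorHomEquiv k V V).surjective g
  change LinearMap.trace k (V ⊗[k] V) (TensorProduct.map (dualTensorHom k V V a)
    (dualTensorHom k V V b) ∘ₗ _) = LinearMap.trace k V (dualTensorHom k V V a ∘ₗ
    dualTensorHom k V V b)
  induction a with
  | zero => simp
  | add a₁ a₂ h₁ h₂ =>
    simp only [map_add, TensorProduct.map_add_left, LinearMap.add_comp, h₁, h₂]
  | tmul a x =>
    induction b with
    | zero => simp
    | add b₁ b₂ h₁ h₂ =>
      simp only [map_add, TensorProduct.map_add_right, LinearMap.add_comp, LinearMap.comp_add,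
        h₁, h₂]
    | tmul b y =>
      -- For rank-one `f = a ⊗ x` and `g = b ⊗ y`, the flip exchanges the functionals; both traces
      -- become `a(y) b(x)`.
      have e : TensorProduct.map (dualTensorHom k V V (a ⊗ₜ x)) (dualTensorHom k V V (b ⊗ₜ y)) ∘ₗ
          (TensorProduct.comm k V V).toLinearMap =
          TensorProduct.map (dualTensorHom k V V (b ⊗ₜ x)) (dualTensorHom k V V (a ⊗ₜ y)) := by
        ext s t
        simp [dualTensorHom_apply, TensorProduct.smul_tmul', TensorProduct.tmul_smul, smul_smul,
          mul_comm]
      rw [e, LinearMap.trace_tensorProduct', comp_dualTensorHom, map_smul]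
      simp [LinearMap.trace_eq_contract_apply, mul_comm]

/-- `tr (x ⊗ (y ⊗ w) ↦ f y ⊗ G (x ⊗ w)) = tr (G ∘ (f ⊗ id))`. -/
lemma trace_map_comp_leftComm (f : Module.End k V) (G : Module.End k (V ⊗[k] W)) :
    LinearMap.trace k (V ⊗[k] (V ⊗[k] W))
        (TensorProduct.map f G ∘ₗ (TensorProduct.leftComm k V V W).toLinearMap) =
      LinearMap.trace k (V ⊗[k] W) (G ∘ₗ TensorProduct.map f LinearMap.id) := by
  let φ : Module.End k (V ⊗[k] W) →ₗ[k] k :=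
    LinearMap.trace k (V ⊗[k] (V ⊗[k] W)) ∘ₗ
      LinearMap.lcomp k _ (TensorProduct.leftComm k V V W).toLinearMap ∘ₗ
      TensorProduct.mapBilinear (.id k) V (V ⊗[k] W) V (V ⊗[k] W) f
  let ψ : Module.End k (V ⊗[k] W) →ₗ[k] k :=
    LinearMap.trace k (V ⊗[k] W) ∘ₗ
      LinearMap.lcomp k (V ⊗[k] W) (TensorProduct.map f LinearMap.id)
  -- By linearity `G = g ⊗ c`, which reduces to the two-factor case times `tr c`.
  have h : φ = ψ := by
    apply end_tensor_hom_ext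
    intro g c
    have e : TensorProduct.map f (TensorProduct.map g c) ∘ₗ
        (TensorProduct.leftComm k V V W).toLinearMap =
        (TensorProduct.assoc k V V W).conj
          (TensorProduct.map (TensorProduct.map f g ∘ₗ (TensorProduct.comm k V V).toLinearMap) c) := by
      ext x y w
      simp [LinearEquiv.conj_apply]
    change LinearMap.trace k _ (TensorProduct.map f (TensorProduct.map g c) ∘ₗ
      (TensorProduct.leftComm k V V W).toLinearMap) =
      LinearMap.trace k _ (TensorProduct.map g c ∘ₗ TensorProduct.map f LinearMap.id)
    rw [e, LinearMap.trace_conj', LinearMap.trace_tensorProduct', trace_map_comp_comm,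
      ← TensorProduct.map_comp, LinearMap.trace_tensorProduct', LinearMap.comp_id,
      ← Module.End.mul_eq_comp, ← Module.End.mul_eq_comp, LinearMap.trace_mul_comm]
  exact LinearMap.congr_fun h G

end CyclicTrace

/-! ### Twisted rotations of tensor powers and Sweedler powers. -/

section Rotation

variable {k V : Type*} [Field k] [AddCommGroup V] [Module k V]

/-- The twisted cyclic rotation `x₁ ⊗ x₂ ⊗ ⋯ ⊗ xₙ₊₁ ↦ x₂ ⊗ ⋯ ⊗ xₙ₊₁ ⊗ A x₁`. -/
noncomputable def twistedRotation (A : Module.End k V) (n : ℕ) :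
    V ⊗[k] (⨂[k]^n V) →ₗ[k] ⨂[k]^(n + 1) V :=
  (snocEquiv k V n).toLinearMap ∘ₗ TensorProduct.map LinearMap.id A ∘ₗ
    (TensorProduct.comm k V (⨂[k]^n V)).toLinearMap

lemma twistedRotation_tmul_tprod (A : Module.End k V) (n : ℕ) (x : V) (a : Fin n → V) :
    twistedRotation A n (x ⊗ₜ PiTensorProduct.tprod k a) =
      PiTensorProduct.tprod k (Fin.snoc a (A x) : Fin (n + 1) → V) := by
  simp [twistedRotation, snocEquiv_tmul]

/-- The recursion behind the trace computation: to rotate `x ⊗ y ⊗ w`, exchange `x` with `y`, then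
rotate `x ⊗ w`. -/
lemma twistedRotation_comp_consEquiv (A : Module.End k V) (n : ℕ) :
    (consEquiv k V (n + 1)).symm.toLinearMap ∘ₗ twistedRotation A (n + 1) ∘ₗ
      TensorProduct.map LinearMap.id (consEquiv k V n).toLinearMap =
    TensorProduct.map LinearMap.id (twistedRotation A n) ∘ₗ
      (TensorProduct.leftComm k V V (⨂[k]^n V)).toLinearMap := by
  ext x y a
  simp [twistedRotation_tmul_tprod, consEquiv_tmul, Fin.cons_snoc_eq_snoc_cons,
    LinearEquiv.symm_apply_eq]

variable {H : Type*} [Ring H] [HopfAlgebra k H]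

lemma sweedlerPower_succ_apply (n : ℕ) (h : H) : sweedlerPower k (n + 1) h =
    ∑ i ∈ (ℛ k h).index, (ℛ k h).left i * sweedlerPower k n ((ℛ k h).right i) := by
  rw [sweedlerPower, LinearMap.comp_apply, LinearMap.comp_apply]
  conv_lhs => rw [← (ℛ k h).eq]
  simp

lemma tensorRep_eq_sum {W : Type*} [AddCommGroup W] [Module k W] (ρ : H →ₐ[k] Module.End k V)
    (σ : H →ₐ[k] Module.End k W) (h : H) : tensorRep ρ σ h = ∑ i ∈ (ℛ k h).index,
      TensorProduct.map (ρ ((ℛ k h).left i)) (σ ((ℛ k h).right i)) := by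
  ext x a
  simp [tensorRep_tmul]

/-- An operator on the first factor is absorbed into the twist; this is how the product of the
`h₍ᵢ₎` accumulates. -/
lemma twistedRotation_comp_map (A X : Module.End k V) (n : ℕ) (B : Module.End k (⨂[k]^n V)) :
    twistedRotation A n ∘ₗ TensorProduct.map X B =
      twistedRotation (A ∘ₗ X) n ∘ₗ TensorProduct.map LinearMap.id B := by
  ext x a
  simp [twistedRotation]

variable [FiniteDimensional k V]

/-- The trace of `x ⊗ w ↦ h w ⊗ A x` on `V ⊗ V^{⊗ n}`. -/
lemma trace_twistedRotation (ρ : H →ₐ[k] Module.End k V) (n : ℕ) (A : Module.End k V) (h : H) :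
    LinearMap.trace k _ ((consEquiv k V n).symm.toLinearMap ∘ₗ twistedRotation A n ∘ₗ
      TensorProduct.map LinearMap.id (powerRep ρ n h)) =
    LinearMap.trace k V (A ∘ₗ ρ (sweedlerPower k n h)) := by
  induction n generalizing A h with
  | zero =>
    have e : (consEquiv k V 0).symm.toLinearMap ∘ₗ twistedRotation A 0 ∘ₗ
        TensorProduct.map LinearMap.id (powerRep ρ 0 h) =
        TensorProduct.map A (counit (R := k) h • LinearMap.id) := by
      -- `V^{⊗0}` is one-dimensional with `h` acting by `ε(h)`, in agreement with the zeroth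
      -- Sweedler power `ε(h) 1`.
      have hP : powerRep ρ 0 h = counit (R := k) h • LinearMap.id := by
        ext a
        obtain ⟨c, hc⟩ := (TensorPower.algebraMap₀ (R := k) (M := V)).surjective
          (PiTensorProduct.tprod k a)
        simp [powerRep, trivialRep, ← hc, ← smul_eq_mul]
      rw [hP]
      ext x a
      have hs : (Fin.snoc a (A x) : Fin 1 → V) = Fin.cons (A x) a := by
        ext i
        rw [Fin.fin_one_eq_zero i]
        simp [Fin.snoc]
      simp [twistedRotation_tmul_tprod, hs, ← consEquiv_tmul]
    have hr : Module.finrank k (⨂[k]^0 V) = 1 := by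
      rw [← (TensorPower.algebraMap₀ (R := k) (M := V)).finrank_eq, Module.finrank_self]
    rw [e, LinearMap.trace_tensorProduct', map_smul, LinearMap.trace_id, hr]
    simp [sweedlerPower, Module.algebraMap_end_eq_smul_id, LinearMap.comp_smul, mul_comm]
  | succ n ih =>
    have h1 : TensorProduct.map LinearMap.id (powerRep ρ (n + 1) h) =
        (TensorProduct.map LinearMap.id (consEquiv k V n).toLinearMap ∘ₗ
        TensorProduct.map LinearMap.id (tensorRep ρ (powerRep ρ n) h)) ∘ₗ
        TensorProduct.map (LinearMap.id : V →ₗ[k] V) (consEquiv k V n).symm.toLinearMap := by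
      rw [← TensorProduct.map_comp, ← TensorProduct.map_comp]
      rfl
    -- The inductive step for one summand of `Δ(h)`: `trace_map_comp_leftComm` removes one factor
    -- `V`, and the operator `X` acting there joins the twist as `A ∘ X`.
    have h3 : ∀ (X : Module.End k V) (B : Module.End k (⨂[k]^n V)),
        LinearMap.trace k _ (TensorProduct.map LinearMap.id (consEquiv k V n).symm.toLinearMap ∘ₗ
          TensorProduct.map LinearMap.id (twistedRotation A n) ∘ₗ
          (TensorProduct.leftComm k V V (⨂[k]^n V)).toLinearMap ∘ₗ
          TensorProduct.map LinearMap.id (TensorProduct.map X B)) =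
        LinearMap.trace k _ ((consEquiv k V n).symm.toLinearMap ∘ₗ twistedRotation (A ∘ₗ X) n ∘ₗ
          TensorProduct.map LinearMap.id B) := by
      intro X B
      have e1 : TensorProduct.map LinearMap.id (consEquiv k V n).symm.toLinearMap ∘ₗ
          TensorProduct.map LinearMap.id (twistedRotation A n) ∘ₗ
          (TensorProduct.leftComm k V V (⨂[k]^n V)).toLinearMap ∘ₗ
          TensorProduct.map LinearMap.id (TensorProduct.map X B) =
          TensorProduct.map X ((consEquiv k V n).symm.toLinearMap ∘ₗ twistedRotation A n ∘ₗ
            TensorProduct.map LinearMap.id B) ∘ₗ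
          (TensorProduct.leftComm k V V (⨂[k]^n V)).toLinearMap := by
        ext x y a
        simp
      rw [e1, trace_map_comp_leftComm, LinearMap.comp_assoc, LinearMap.comp_assoc,
        ← TensorProduct.map_comp, LinearMap.id_comp, LinearMap.comp_id, twistedRotation_comp_map]
    rw [h1, ← LinearMap.comp_assoc, ← LinearMap.comp_assoc, LinearMap.trace_comp_comm',
      LinearMap.comp_assoc, ← LinearMap.comp_assoc _ _ (consEquiv k V (n + 1)).symm.toLinearMap,
      ← LinearMap.comp_assoc _ _ ((consEquiv k V (n + 1)).symm.toLinearMap ∘ₗ _),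
      LinearMap.comp_assoc (TensorProduct.map LinearMap.id (consEquiv k V n).toLinearMap),
      twistedRotation_comp_consEquiv, tensorRep_eq_sum]
    -- Both sides are written as linear functionals so that the sum over `Δ(h)` can be pulled out.
    let Ψ : Module.End k (V ⊗[k] ⨂[k]^n V) →ₗ[k] k := LinearMap.trace k _ ∘ₗ
      LinearMap.compRight k (TensorProduct.map LinearMap.id (consEquiv k V n).symm.toLinearMap ∘ₗ
          TensorProduct.map LinearMap.id (twistedRotation A n) ∘ₗ
          (TensorProduct.leftComm k V V (⨂[k]^n V)).toLinearMap) ∘ₗ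
      TensorProduct.mapBilinear (.id k) V (V ⊗[k] ⨂[k]^n V) V (V ⊗[k] ⨂[k]^n V) LinearMap.id
    let Ξ : Module.End k V →ₗ[k] k := LinearMap.trace k V ∘ₗ LinearMap.compRight k A
    change Ψ _ = Ξ _
    rw [sweedlerPower_succ_apply]
    simp only [map_sum, map_mul]
    refine Finset.sum_congr rfl fun i _ => ?_
    exact (h3 _ _).trans (ih _ _)

/-- The trace of `x ⊗ w ↦ h₍₂₎ w ⊗ A h₍₁₎ x` on `V ⊗ V^{⊗ n}`. -/
lemma trace_twistedRotation_comp_tensorRep (ρ : H →ₐ[k] Module.End k V) (n : ℕ)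
    (A : Module.End k V) (h : H) :
    LinearMap.trace k _ ((consEquiv k V n).symm.toLinearMap ∘ₗ twistedRotation A n ∘ₗ
      tensorRep ρ (powerRep ρ n) h) =
    LinearMap.trace k V (A ∘ₗ ρ (sweedlerPower k (n + 1) h)) := by
  let Ψ : Module.End k (V ⊗[k] ⨂[k]^n V) →ₗ[k] k := LinearMap.trace k _ ∘ₗ
    LinearMap.compRight k ((consEquiv k V n).symm.toLinearMap ∘ₗ twistedRotation A n)
  let Ξ : Module.End k V →ₗ[k] k := LinearMap.trace k V ∘ₗ LinearMap.compRight k A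
  change Ψ _ = Ξ _
  rw [sweedlerPower_succ_apply, tensorRep_eq_sum]
  simp only [map_sum, map_mul]
  refine Finset.sum_congr rfl fun i _ => ?_
  change LinearMap.trace k _ ((_ ∘ₗ _) ∘ₗ _) = LinearMap.trace k V (A ∘ₗ _)
  rw [LinearMap.comp_assoc, twistedRotation_comp_map, trace_twistedRotation]
  rfl

end Rotation

/-! ### The trace of `E_V^n`. -/

section Indicator

/-- `LinearMap.trace_comp_comm'` over a field, for modules given as additive monoids. -/
lemma trace_comp_comm_of_field {k M N : Type*} [Field k] [AddCommMonoid M] [Module k M]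
    [AddCommMonoid N] [Module k N] [Module.Finite k M] [Module.Finite k N]
    (f : M →ₗ[k] N) (g : N →ₗ[k] M) :
    LinearMap.trace k M (g ∘ₗ f) = LinearMap.trace k N (f ∘ₗ g) := by
  let _ := Module.addCommMonoidToAddCommGroup k (M := M)
  let _ := Module.addCommMonoidToAddCommGroup k (M := N)
  exact LinearMap.trace_comp_comm' f g

variable {k H V : Type*} [Field k] [Ring H] [HopfAlgebra k H] [AddCommGroup V] [Module k V]
  [FiniteDimensional k V]

/-- Identifies `E_V^{n+1}`, read at `1 ∈ k`, with the rotation twisted by `u⁻¹`. -/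
lemma rotate_apply_one (ρ : H →ₐ[k] Module.End k V) (u : Hˣ) (n : ℕ)
    (f : k →ₗ[k] ⨂[k]^(n + 1) V) :
    rotate ρ u n f 1 = twistedRotation (ρ ↑u⁻¹) n ((consEquiv k V n).symm (f 1)) := by
  let b := Module.Basis.ofVectorSpace k (Module.Dual k V)
  have key : ∀ t : V ⊗[k] ⨂[k]^n V,
      snocEquiv k V n (TensorProduct.map LinearMap.id (jEquiv ρ u).symm.toLinearMap
        (∑ i, evFirst k V (Module.Dual k (Module.Dual k V)) n
          (b i ⊗ₜ (consEquiv k V n t ⊗ₜ b.coord i)))) = twistedRotation (ρ ↑u⁻¹) n t := by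
    intro t
    induction t with
    | zero => simp
    | add x y hx hy =>
      rw [map_add, map_add, ← hx, ← hy]
      simp only [TensorProduct.add_tmul, TensorProduct.tmul_add, map_add, Finset.sum_add_distrib]
    | tmul x w =>
      -- Contracting `∑ bᵢ ⊗ bᵢ*` with `x` gives evaluation at `x` in `V**`, and `j⁻¹` sends this to
      -- `u⁻¹ x`.
      have hj : (jEquiv ρ u).symm (∑ i, b i x • b.coord i) = ρ ↑u⁻¹ x := by
        rw [LinearEquiv.symm_apply_eq]
        ext f
        rw [jEquiv_apply, ← Module.End.mul_apply, ← map_mul, Units.mul_inv, map_one]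
        conv_rhs => rw [← b.sum_repr f]
        simp only [LinearMap.sum_apply, LinearMap.smul_apply, smul_eq_mul,
          Module.Basis.coord_apply]
        exact Finset.sum_congr rfl fun i _ => mul_comm _ _
      simp [evFirst, twistedRotation, ← hj, TensorProduct.tmul_sum, TensorProduct.smul_tmul]
  rw [← key, LinearEquiv.apply_symm_apply]
  simp [rotate, coevaluation_apply_one, map_sum, b]

/-- With `ι : f ↦ f(1)` and `π` the action of `Λ` with values in the invariants, `E = π T ι` and `ι
π = Λ`, so `tr E = tr(T Λ)` by cyclicity. -/
lemma trace_fsOperator (ρ : H →ₐ[k] Module.End k V) (u : Hˣ)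
    (hu : ∀ h : H, HopfAlgebra.antipode k (HopfAlgebra.antipode k h) = u * h * ↑u⁻¹) (n : ℕ)
    {Λ : H} (hΛ : IsIntegral k Λ) (h1 : counit (R := k) Λ = 1) :
    LinearMap.trace k _ (fsOperator ρ u hu n) =
      character ρ (↑u⁻¹ * sweedlerPower k (n + 1) Λ) := by
  let ι : homH (trivialRep k H) (powerRep ρ (n + 1)) →ₗ[k] ⨂[k]^(n + 1) V :=
    LinearMap.applyₗ (1 : k) ∘ₗ Submodule.subtype _
  let π : (⨂[k]^(n + 1) V) →ₗ[k] homH (trivialRep k H) (powerRep ρ (n + 1)) :=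
    LinearMap.codRestrict _ ((LinearMap.ringLmapEquivSelf k k _).symm.toLinearMap ∘ₗ
      powerRep ρ (n + 1) Λ) (fun m => by
        intro h
        ext
        simp [trivialRep, ← Module.End.mul_apply, ← map_mul, hΛ h])
  let T : Module.End k (⨂[k]^(n + 1) V) :=
    twistedRotation (ρ ↑u⁻¹) n ∘ₗ (consEquiv k V n).symm.toLinearMap
  have hE : fsOperator ρ u hu n = π ∘ₗ T ∘ₗ ι := by
    refine LinearMap.ext fun f => Subtype.ext (LinearMap.ext_ring ?_)
    -- Since `E f` is `H`-linear and `ε(Λ) = 1`, `Λ` fixes `(E f)(1)`; thus inserting `π` changes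
    -- nothing.
    have hf := LinearMap.congr_fun ((fsOperator ρ u hu n f).2 Λ) 1
    simp only [LinearMap.comp_apply, trivialRep, AlgHom.comp_apply, Bialgebra.counitAlgHom_apply,
      h1, map_one, Module.End.one_apply] at hf
    have hr : (fsOperator ρ u hu n f : k →ₗ[k] ⨂[k]^(n + 1) V) 1 = T (ι f) :=
      rotate_apply_one ρ u n f
    change _ = (LinearMap.ringLmapEquivSelf k k _).symm (powerRep ρ (n + 1) Λ (T (ι f))) 1
    rw [← hr]
    exact hf.trans (one_smul k _).symm
  have hπ : ι ∘ₗ π = powerRep ρ (n + 1) Λ := by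
    refine LinearMap.ext fun m => ?_
    change (LinearMap.ringLmapEquivSelf k k _).symm (powerRep ρ (n + 1) Λ m) 1 = _
    simp
  have hP : powerRep ρ (n + 1) Λ = ((consEquiv k V n).toLinearMap ∘ₗ
      tensorRep ρ (powerRep ρ n) Λ) ∘ₗ (consEquiv k V n).symm.toLinearMap := rfl
  have hfin : Module.Finite k (homH (trivialRep k H) (powerRep ρ (n + 1))) :=
    Module.Finite.of_injective ι fun f g hfg => Subtype.ext (LinearMap.ext_ring hfg)
  rw [hE, trace_comp_comm_of_field, LinearMap.comp_assoc, hπ, hP, ← LinearMap.comp_assoc,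
    trace_comp_comm_of_field]
  have hc : (consEquiv k V n).symm.toLinearMap ∘ₗ T ∘ₗ (consEquiv k V n).toLinearMap ∘ₗ
      tensorRep ρ (powerRep ρ n) Λ = (consEquiv k V n).symm.toLinearMap ∘ₗ
      twistedRotation (ρ ↑u⁻¹) n ∘ₗ tensorRep ρ (powerRep ρ n) Λ := by
    refine LinearMap.ext fun x => ?_
    simp [T]
  rw [hc, trace_twistedRotation_comp_tensorRep, character, map_mul, Module.End.mul_eq_comp]

end Indicator

end HopfFS

/-- `H` is a finite-dimensional semisimple Hopf algebra over an algebraically closed field `k` whose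
characteristic `p` satisfies `p > (dim H)^{1/2}` (or `p = 0`), and `V` is a finite-dimensional
representation of `H`. The idempotent integral `Λ₀` normalises the operators `E_V^n`. -/
theorem mainTheorem2 {k : Type*} {H : Type*} {V : Type*} [Field k] [IsAlgClosed k]
    [Ring H] [HopfAlgebra k H] [FiniteDimensional k H] [IsSemisimpleRing H]
    (p : ℕ) [CharP k p] (hp : p = 0 ∨ Real.sqrt (Module.finrank k H) < p)
    [AddCommGroup V] [Module k V] [FiniteDimensional k V] (ρ : H →ₐ[k] Module.End k V) :
    (∃! Λ₀ : H, HopfFS.IsIntegral k Λ₀ ∧ Λ₀ ≠ 0 ∧ IsIdempotentElem Λ₀) ∧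
    ∀ Λ₀ : H, HopfFS.IsIntegral k Λ₀ → Λ₀ ≠ 0 → IsIdempotentElem Λ₀ →
      ∃ (u₀ : Hˣ) (hu₀ : ∀ h : H,
          HopfAlgebra.antipode k (HopfAlgebra.antipode k h) = u₀ * h * ↑u₀⁻¹),
        (u₀ : H) = HopfFS.uElement k Λ₀ ∧
        ∀ Λ : H, HopfFS.IsIntegral k Λ → Λ ≠ 0 →
          ∃ u : Hˣ, (u : H) = HopfFS.uElement k Λ ∧
            ∀ (n : ℕ) (hn : 1 ≤ n),
              HopfFS.fsIndicator ρ u₀ hu₀ n hn =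
                HopfFS.character ρ (↑u⁻¹ * HopfFS.sweedlerPower k n Λ) := by
  refine ⟨HopfFS.existsUnique_idempotent_integral k H, fun Λ₀ hΛ₀ h0 hi => ?_⟩
  obtain ⟨u₀, hu₀⟩ := hΛ₀.isUnit_uElement p hp h0
  have hconj : ∀ h : H,
      HopfAlgebra.antipode k (HopfAlgebra.antipode k h) = u₀ * h * ↑u₀⁻¹ := fun h => by
    rw [Units.eq_mul_inv_iff_mul_eq, hu₀, hΛ₀.uElement_mul]
  refine ⟨u₀, hconj, hu₀, fun Λ hΛ hΛ0 => ?_⟩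
  obtain ⟨u, hu⟩ := hΛ.isUnit_uElement p hp hΛ0
  refine ⟨u, hu, fun n hn => ?_⟩
  have h1 := hΛ₀.counit_eq_one h0 hi
  -- The product `Λ * Λ₀` is evaluated with each factor as an integral.
  have hscale : Λ = Coalgebra.counit (R := k) Λ • Λ₀ := by
    rw [← hΛ₀ Λ, hΛ.mul_right, h1, one_smul]
  -- Both `u` and the Sweedler power are linear in the integral, so the factor `ε(Λ)` cancels.
  have hsw : ↑u⁻¹ * HopfFS.sweedlerPower k n Λ = ↑u₀⁻¹ * HopfFS.sweedlerPower k n Λ₀ := by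
    rw [Units.inv_mul_eq_iff_eq_mul, hu, hscale, HopfFS.uElement_smul, ← hu₀, smul_mul_assoc,
      Units.mul_inv_cancel_left, map_smul]
  rw [hsw]
  obtain ⟨m, rfl⟩ : ∃ m, n = m + 1 := ⟨n - 1, by omega⟩
  exact HopfFS.trace_fsOperator ρ u₀ hconj m hΛ₀ h1
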